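/- Let $n\ge 0$ and let $\mathfrak S_n$ be the set of permutations $\pi=\pi_1\pi_2\cdots\pi_n$ of $[n]=\{1,\dots,n\}$. A permutation contains a pattern $p_1\cdots p_k$ if it has a subsequence that is order isomorphic to $p_1\cdots p_k$; otherwise it avoids it. Write $\mathfrak S_n(P)$ for the set of $\pi\in\mathfrak S_n$ that avoid every pattern in $P$. For $\pi\in\mathfrak S_n$ put $$\mathrm{LMAX}(\pi)=\{\pi_i:\pi_j<\pi_i\ \forall\,1\le j<i\},\qquad \mathrm{LMIN}(\pi)=\{\pi_i:\pi_j>\pi_i\ \forall\,1\le j<i\},$$ $$\mathrm{DES}(\pi)=\{i\in[n-1]:\pi_i>\pi_{i+1}\},\qquad \mathrm{DESB}(\pi)=\{\pi_{i+1}:i\in\mathrm{DES}(\pi)\},$$ $$\mathsf{iar}(\pi)=\min(\mathrm{DES}(\pi)\cup\{n\}),\qquad \mathsf{comp}(\pi)=|\{i\in[n]:\pi_j\le i\ \forall\, 1\le j\le i\}|.$$ Theorem. We have $\mathfrak S_n(312)\subseteq\mathfrak S_n(2413,3142)$, and there is an involution $\Phi$ on the set $\mathfrak S_n(2413,3142)$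 of separable permutations such that, for every $\pi$ in this set, $\mathrm{LMAX}(\Phi(\pi))=\mathrm{LMAX}(\pi)$, $\mathrm{LMIN}(\Phi(\pi))=\mathrm{LMIN}(\pi)$, $\mathrm{DESB}(\Phi(\pi))=\mathrm{DESB}(\pi)$, $\mathsf{comp}(\Phi(\pi))=\mathsf{iar}(\pi)$ and $\mathsf{iar}(\Phi(\pi))=\mathsf{comp}(\pi)$. Moreover, this same $\Phi$ maps $\mathfrak S_n(312)$ to itself, and so restricts to an involution on $\mathfrak S_n(312)$. Consequently, for $S=\mathfrak S_n(2413,3142)$ and for $S=\mathfrak S_n(312)$, the quintuples $(\mathrm{LMAX},\mathrm{LMIN},\mathrm{DESB},\mathsf{iar},\mathsf{comp})$ and $(\mathrm{LMAX},\mathrm{LMIN},\mathrm{DESB},\mathsf{comp},\mathsf{iar})$ are equidistributed on $S$, i.e. every value is taken by both quintuples for the same number of $\pi\in S$. -/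

import Mathlib

/-! A permutation `π = π₁π₂⋯πₙ` of `[n] = {1, …, n}` is an element of `Equiv.Perm (Fin n)`; the index
`i : Fin n` stands for the position `i + 1`, and the letter at that position is `π i + 1`. -/

namespace PermStat

variable {n : ℕ}

/-- The letter of `π` at the (zero-based) index `i`, as an element of `{1, …, n}`. -/
def letter (π : Equiv.Perm (Fin n)) (i : Fin n) : ℕ := (π i : ℕ) + 1

/-- `π` contains the pattern `p` (a word such as `[2, 4, 1, 3]`): some subsequence of `π` is
order isomorphic to `p`. -/
def Contains (π : Equiv.Perm (Fin n)) (p : List ℕ) : Prop :=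
  ∃ f : Fin p.length → Fin n, StrictMono f ∧
    ∀ a b : Fin p.length, letter π (f a) < letter π (f b) ↔ p.get a < p.get b

/-- `𝔖ₙ(P)`: the permutations of length `n` that avoid every pattern in `P`. -/
def Av (n : ℕ) (P : Set (List ℕ)) : Set (Equiv.Perm (Fin n)) :=
  {π | ∀ p ∈ P, ¬ Contains π p}

/-- Values of the left-to-right maxima. -/
def LMAX (π : Equiv.Perm (Fin n)) : Finset ℕ :=
  (Finset.univ.filter fun i : Fin n => ∀ j : Fin n, j < i → letter π j < letter π i).image (letter π)

/-- Values of the left-to-right minima. -/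
def LMIN (π : Equiv.Perm (Fin n)) : Finset ℕ :=
  (Finset.univ.filter fun i : Fin n => ∀ j : Fin n, j < i → letter π i < letter π j).image (letter π)

/-- The (one-based) positions of descents: `i ∈ [n-1]` with `πᵢ > πᵢ₊₁`. -/
def DES (π : Equiv.Perm (Fin n)) : Finset ℕ :=
  (Finset.univ.filter fun i : Fin n =>
    ∃ j : Fin n, (j : ℕ) = (i : ℕ) + 1 ∧ letter π j < letter π i).image
    (fun i : Fin n => (i : ℕ) + 1)

/-- The set of descent bottoms: the letters `πᵢ₊₁` with `i ∈ DES π`. -/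
def DESB (π : Equiv.Perm (Fin n)) : Finset ℕ :=
  (Finset.univ.filter fun j : Fin n =>
    ∃ i : Fin n, (j : ℕ) = (i : ℕ) + 1 ∧ (i : ℕ) + 1 ∈ DES π).image (letter π)

/-- The length of the initial ascending run, `min (DES π ∪ {n})`. -/
def iar (π : Equiv.Perm (Fin n)) : ℕ :=
  (insert n (DES π)).min' (Finset.insert_nonempty n (DES π))

/-- The number of components: the number of positions `i ∈ [n]` with `πⱼ ≤ i` for all `j ≤ i`. -/
def comp (π : Equiv.Perm (Fin n)) : ℕ :=
  (Finset.univ.filter fun i : Fin n => ∀ j : Fin n, j ≤ i → letter π j ≤ (i : ℕ) + 1).card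

/-- Two statistics `f` and `g` are equidistributed on a (finite) set `S`: every value is taken
equally often. -/
def Equidistributed {α β : Type*} (S : Set α) (f g : α → β) : Prop :=
  ∀ b : β, {x ∈ S | f x = b}.ncard = {x ∈ S | g x = b}.ncard

end PermStat

/-!
Every nonempty separable permutation is `1 ⊕ r` or `(a ⊖ b) ⊕ r` with `a`, `b` nonempty and `r`
possibly empty, uniquely so once `b` is required to be skew indecomposable. It is therefore a list
of `⊕`-components, and it is encoded by a ternary tree (`SepTree`).

For fixed `b`, the sets of left-to-right maxima, left-to-right minima and descent bottoms of
`(a ⊖ b) ⊕ r` depend on `a` and `r` only through `a ⊕ r` (`stats_skew`, `Same.minus`). Hence the place at which the list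
of components of `a ⊕ r` is cut into `a` and `r` is free. The number of components is
`1 + comp r`, and the length of the initial run is that of `a`.

The bijection `theta` sends `(a ⊖ b) ⊕ r` to the permutation with the same `b`, for which
`theta a ⊕ r` is cut so that the second part has `comp (theta a) - 1` components and the first one
`comp r + 1`. By induction `comp (theta t) = iar t`, the set-valued statistics are kept, and cutting
a second time undoes the map. The involution `swap` fixes the leading letters `1 ⊕ 1 ⊕ ⋯`, and on
the rest `(a ⊖ b) ⊕ r` it exchanges `iar a` and `comp r + 1`: replace `a` by `theta a`, so that
both are numbers of components, move the cut in `theta a ⊕ r` as before, and apply `theta⁻¹` to the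
new first part. A separable permutation avoids `312` exactly if each `b` in its decomposition is a
single letter, a condition which all these maps respect.

To transfer this to permutations, the statistics are computed on words. A separable word splits
into a direct or a skew sum by induction on its length (`exists_split`), and the decomposition is
unique since a word with a direct cut has its first letter below its last, while a skew cut puts
it above (`not_below_above`).
-/

/-! ### Decomposition trees -/

/-- Decomposition trees of separable permutations: `nil` is the empty permutation, `one r` is
`1 ⊕ r`, and `minus a b r` is `(a ⊖ b) ⊕ r`. A tree is thus read as the list of its
`⊕`-components; the normal form `SepTree.Valid` makes the encoding unique. -/
inductive SepTree : Type
  | nil : SepTree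
  | one (r : SepTree) : SepTree
  | minus (a b r : SepTree) : SepTree

namespace SepTree

/-- The length of the permutation. -/
def size : SepTree → ℕ
  | nil => 0
  | one r => r.size + 1
  | minus a b r => a.size + b.size + r.size

/-- The number of nodes; used only as a termination measure. -/
def nodes : SepTree → ℕ
  | nil => 0
  | one r => r.nodes + 1
  | minus a b r => a.nodes + b.nodes + r.nodes + 1

/-- The number of `⊕`-components. -/
def comp : SepTree → ℕ
  | nil => 0
  | one r => r.comp + 1
  | minus _ _ r => r.comp + 1

/-- The length of the initial ascending run. -/
def iar : SepTree → ℕ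
  | nil => 0
  | one r => r.iar + 1
  | minus a _ _ => a.iar

/-- Nonempty and not a skew sum of two nonempty permutations: `1 ⊕ r`, or `(a ⊖ b) ⊕ r` with `r`
nonempty. -/
def SkewIndec : SepTree → Prop
  | nil => False
  | one _ => True
  | minus _ _ nil => False
  | minus _ _ _ => True

/-- The normal form: in every `(a ⊖ b) ⊕ r`, the part `a` is nonempty and `b` is the last
skew component. -/
def Valid : SepTree → Prop
  | nil => True
  | one r => r.Valid
  | minus a b r => a.Valid ∧ b.Valid ∧ r.Valid ∧ a ≠ nil ∧ b.SkewIndec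

/-- The trees (in normal form) of `312`-avoiding permutations: every `b` in an `(a ⊖ b) ⊕ r` is a
single letter. -/
def Simple : SepTree → Prop
  | nil => True
  | one r => r.Simple
  | minus a b r => a.Simple ∧ b = one nil ∧ r.Simple

/-- The direct sum `t ⊕ u`. -/
def app : SepTree → SepTree → SepTree
  | nil, u => u
  | one r, u => one (r.app u)
  | minus a b r, u => minus a b (r.app u)

/-- The first `k` components. -/
def take : ℕ → SepTree → SepTree
  | 0, _ => nil
  | _ + 1, nil => nil
  | k + 1, one r => one (take k r)
  | k + 1, minus a b r => minus a b (take k r)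

/-- All but the first `k` components. -/
def drop : ℕ → SepTree → SepTree
  | 0, t => t
  | _ + 1, nil => nil
  | k + 1, one r => drop k r
  | k + 1, minus _ _ r => drop k r

theorem take_app_drop (k : ℕ) (t : SepTree) : (take k t).app (drop k t) = t := by
  induction t generalizing k with
  | nil => cases k <;> rfl
  | one r ih => cases k <;> simp [take, drop, app, ih]
  | minus a b r _ _ ih => cases k <;> simp [take, drop, app, ih]

theorem comp_app (t u : SepTree) : (t.app u).comp = t.comp + u.comp := by
  induction t with
  | nil => simp [app, comp]
  | one r ih => simp only [app, comp, ih]; omega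
  | minus a b r _ _ ih => simp only [app, comp, ih]; omega

theorem size_app (t u : SepTree) : (t.app u).size = t.size + u.size := by
  induction t with
  | nil => simp [app, size]
  | one r ih => simp only [app, size, ih]; omega
  | minus a b r _ _ ih => simp only [app, size, ih]; omega

theorem nodes_app (t u : SepTree) : (t.app u).nodes = t.nodes + u.nodes := by
  induction t with
  | nil => simp [app, nodes]
  | one r ih => simp only [app, nodes, ih]; omega
  | minus a b r _ _ ih => simp only [app, nodes, ih]; omega

theorem nodes_take_le (k : ℕ) (t : SepTree) : (take k t).nodes ≤ t.nodes := by
  conv_rhs => rw [← take_app_drop k t, nodes_app]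
  omega

theorem valid_app {t u : SepTree} : (t.app u).Valid ↔ t.Valid ∧ u.Valid := by
  induction t with
  | nil => simp [app, Valid]
  | one r ih => simpa [app, Valid] using ih
  | minus a b r _ _ ih => simp only [app, Valid, ih]; tauto

theorem simple_app {t u : SepTree} : (t.app u).Simple ↔ t.Simple ∧ u.Simple := by
  induction t with
  | nil => simp [app, Simple]
  | one r ih => simpa [app, Simple] using ih
  | minus a b r _ _ ih => simp only [app, Simple, ih]; tauto

theorem valid_take_drop {t : SepTree} (k : ℕ) (h : t.Valid) :
    (take k t).Valid ∧ (drop k t).Valid := by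
  rwa [← valid_app, take_app_drop]

theorem simple_take_drop {t : SepTree} (k : ℕ) (h : t.Simple) :
    (take k t).Simple ∧ (drop k t).Simple := by
  rwa [← simple_app, take_app_drop]

theorem comp_drop (k : ℕ) (t : SepTree) : (drop k t).comp = t.comp - k := by
  induction t generalizing k with
  | nil => cases k <;> simp [drop, comp]
  | one r ih => cases k <;> simp [drop, comp, ih]
  | minus a b r _ _ ih => cases k <;> simp [drop, comp, ih]

theorem take_comp_app (t u : SepTree) : take t.comp (t.app u) = t := by
  induction t with
  | nil => simp [app, comp, take]
  | one r ih => simp [app, comp, take, ih]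
  | minus a b r _ _ ih => simp [app, comp, take, ih]

theorem drop_comp_app (t u : SepTree) : drop t.comp (t.app u) = u := by
  induction t with
  | nil => simp [app, comp, drop]
  | one r ih => simp [app, comp, drop, ih]
  | minus a b r _ _ ih => simp [app, comp, drop, ih]

theorem take_succ_ne_nil (k : ℕ) {t : SepTree} (h : t ≠ nil) : take (k + 1) t ≠ nil := by
  cases t <;> simp_all [take]

theorem comp_pos {t : SepTree} (h : t ≠ nil) : 0 < t.comp := by
  cases t <;> simp_all [comp]

theorem app_ne_nil {t : SepTree} (u : SepTree) (h : t ≠ nil) : t.app u ≠ nil := by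
  cases t <;> simp_all [app]

theorem iar_pos {t : SepTree} (ht : t.Valid) (h : t ≠ nil) : 0 < t.iar := by
  induction t with
  | nil => exact absurd rfl h
  | one r _ => simp [iar]
  | minus a b r iha _ _ => exact iha ht.1 ht.2.2.2.1

theorem size_pos {t : SepTree} (ht : t.Valid) (h : t ≠ nil) : 0 < t.size := by
  induction t with
  | nil => exact absurd rfl h
  | one r _ => simp [size]
  | minus a b r iha _ _ => have := iha ht.1 ht.2.2.2.1; simp only [size]; omega

theorem SkewIndec.ne_nil {t : SepTree} (h : t.SkewIndec) : t ≠ nil := by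
  rintro rfl; exact h

/-! ### Transforming the initial run into components -/

/-- A bijection that turns the length of the initial run into the number of components. The
components of `theta a ⊕ r` are kept in order and only the place of the cut between the two parts
moves: if the parts had `p + 1` and `q` components, they get `q + 1` and `p`. -/
def theta : SepTree → SepTree
  | nil => nil
  | one r => one r.theta
  | minus a b r => minus (take (r.comp + 1) (a.theta.app r)) b (drop (r.comp + 1) (a.theta.app r))

/-- The inverse of `theta`. -/
def thetaInv : SepTree → SepTree
  | nil => nil
  | one r => one r.thetaInv
  | minus a b r =>
    minus (thetaInv (take (r.comp + 1) (a.app r))) b (drop (r.comp + 1) (a.app r))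
termination_by t => t.nodes
decreasing_by
  · simp [nodes]
  · have h := nodes_take_le (r.comp + 1) (a.app r)
    rw [nodes_app] at h
    simp only [nodes]
    omega

/-- The involution on trees. It keeps the leading single letters; on the rest it agrees with
`theta`, except that `thetaInv` is then applied to the new first part. -/
def swap : SepTree → SepTree
  | nil => nil
  | one r => one r.swap
  | minus a b r =>
    minus (thetaInv (take (r.comp + 1) (a.theta.app r))) b (drop (r.comp + 1) (a.theta.app r))

theorem theta_ne_nil {t : SepTree} (h : t ≠ nil) : t.theta ≠ nil := by
  cases t <;> simp_all [theta]

theorem thetaInv_ne_nil {t : SepTree} (h : t ≠ nil) : t.thetaInv ≠ nil := by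
  cases t <;> simp_all [thetaInv]

theorem theta_valid {t : SepTree} (ht : t.Valid) : t.theta.Valid := by
  induction t with
  | nil => exact ht
  | one r ih => exact ih ht
  | minus a b r iha _ _ =>
    obtain ⟨ha, hb, hr, hne, hi⟩ := ht
    have h := valid_take_drop (r.comp + 1) (valid_app.2 ⟨iha ha, hr⟩)
    exact ⟨h.1, hb, h.2, take_succ_ne_nil _ (app_ne_nil _ (theta_ne_nil hne)), hi⟩

theorem theta_simple {t : SepTree} (ht : t.Simple) : t.theta.Simple := by
  induction t with
  | nil => exact ht
  | one r ih => exact ih ht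
  | minus a b r iha _ _ =>
    obtain ⟨ha, hb, hr⟩ := ht
    have h := simple_take_drop (r.comp + 1) (simple_app.2 ⟨iha ha, hr⟩)
    exact ⟨h.1, hb, h.2⟩

theorem thetaInv_valid {t : SepTree} (ht : t.Valid) : t.thetaInv.Valid := by
  induction t using thetaInv.induct with
  | case1 => simpa [thetaInv] using ht
  | case2 r ih => rw [thetaInv]; exact ih ht
  | case3 a b r ih =>
    obtain ⟨ha, hb, hr, hne, hi⟩ := ht
    have h := valid_take_drop (r.comp + 1) (valid_app.2 ⟨ha, hr⟩)
    rw [thetaInv]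
    exact ⟨ih h.1, hb, h.2, thetaInv_ne_nil (take_succ_ne_nil _ (app_ne_nil _ hne)), hi⟩

theorem thetaInv_simple {t : SepTree} (ht : t.Simple) : t.thetaInv.Simple := by
  induction t using thetaInv.induct with
  | case1 => simpa [thetaInv] using ht
  | case2 r ih => rw [thetaInv]; exact ih ht
  | case3 a b r ih =>
    obtain ⟨ha, hb, hr⟩ := ht
    have h := simple_take_drop (r.comp + 1) (simple_app.2 ⟨ha, hr⟩)
    rw [thetaInv]
    exact ⟨ih h.1, hb, h.2⟩

/-- Cutting `a ⊕ r` so as to exchange the lengths, and then cutting again, gives back `a` and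
`r`. -/
theorem recut {a : SepTree} (r : SepTree) (ha : a ≠ nil) :
    take ((drop (r.comp + 1) (a.app r)).comp + 1) (a.app r) = a ∧
      drop ((drop (r.comp + 1) (a.app r)).comp + 1) (a.app r) = r := by
  have h : (drop (r.comp + 1) (a.app r)).comp + 1 = a.comp := by
    rw [comp_drop, comp_app]
    have := comp_pos ha
    omega
  rw [h]
  exact ⟨take_comp_app a r, drop_comp_app a r⟩

theorem thetaInv_theta {t : SepTree} (ht : t.Valid) : t.theta.thetaInv = t := by
  induction t with
  | nil => simp [theta, thetaInv]
  | one r ih => simp [theta, thetaInv, ih ht]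
  | minus a b r iha _ _ =>
    obtain ⟨ha, hb, hr, hne, hi⟩ := ht
    have h := recut r (theta_ne_nil hne)
    rw [theta, thetaInv, take_app_drop, h.1, h.2, iha ha]

theorem theta_thetaInv {t : SepTree} (ht : t.Valid) : t.thetaInv.theta = t := by
  induction t using thetaInv.induct with
  | case1 => simp [theta, thetaInv]
  | case2 r ih => simp [theta, thetaInv, ih ht]
  | case3 a b r ih =>
    obtain ⟨ha, hb, hr, hne, hi⟩ := ht
    have h := recut r hne
    have hv := valid_take_drop (r.comp + 1) (valid_app.2 ⟨ha, hr⟩)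
    rw [thetaInv, theta, ih hv.1, take_app_drop, h.1, h.2]

theorem comp_theta {t : SepTree} (ht : t.Valid) : t.theta.comp = t.iar := by
  induction t with
  | nil => rfl
  | one r ih => simp [theta, comp, iar, ih ht]
  | minus a b r iha _ _ =>
    obtain ⟨ha, hb, hr, hne, hi⟩ := ht
    have := iar_pos ha hne
    simp only [theta, comp, iar, comp_drop, comp_app, iha ha]
    omega

theorem swap_valid {t : SepTree} (ht : t.Valid) : t.swap.Valid := by
  induction t with
  | nil => exact ht
  | one r ih => exact ih ht
  | minus a b r _ _ _ =>
    obtain ⟨ha, hb, hr, hne, hi⟩ := ht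
    have h := valid_take_drop (r.comp + 1) (valid_app.2 ⟨theta_valid ha, hr⟩)
    exact ⟨thetaInv_valid h.1, hb, h.2,
      thetaInv_ne_nil (take_succ_ne_nil _ (app_ne_nil _ (theta_ne_nil hne))), hi⟩

theorem swap_simple {t : SepTree} (ht : t.Simple) : t.swap.Simple := by
  induction t with
  | nil => exact ht
  | one r ih => exact ih ht
  | minus a b r _ _ _ =>
    obtain ⟨ha, hb, hr⟩ := ht
    have h := simple_take_drop (r.comp + 1) (simple_app.2 ⟨theta_simple ha, hr⟩)
    exact ⟨thetaInv_simple h.1, hb, h.2⟩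

theorem swap_swap {t : SepTree} (ht : t.Valid) : t.swap.swap = t := by
  induction t with
  | nil => rfl
  | one r ih => simp [swap, ih ht]
  | minus a b r _ _ _ =>
    obtain ⟨ha, hb, hr, hne, hi⟩ := ht
    have h := recut r (theta_ne_nil hne)
    have hv := valid_take_drop (r.comp + 1) (valid_app.2 ⟨theta_valid ha, hr⟩)
    rw [swap, swap, theta_thetaInv hv.1, take_app_drop, h.1, h.2, thetaInv_theta ha]

theorem comp_swap {t : SepTree} (ht : t.Valid) : t.swap.comp = t.iar := by
  induction t with
  | nil => rfl
  | one r ih => simp [swap, comp, iar, ih ht]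
  | minus a b r _ _ _ => exact comp_theta ht

theorem iar_swap {t : SepTree} (ht : t.Valid) : t.swap.iar = t.comp := by
  conv_rhs => rw [← swap_swap ht, comp_swap (swap_valid ht)]

/-! ### Statistics of words -/

/-- Every letter of the first word is smaller than every letter of the second. -/
def Below {α : Type*} [LT α] (l m : List α) : Prop := ∀ x ∈ l, ∀ y ∈ m, x < y

/-- The letters `v` with `r x v` for every earlier letter `x`: left-to-right maxima for `<`,
left-to-right minima for `>`. -/
def records (r : ℕ → ℕ → Prop) (l : List ℕ) : Set ℕ :=
  {v | ∃ i, l[i]? = some v ∧ ∀ x ∈ l.take i, r x v}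

/-- The letters preceded by a larger letter. -/
def descentBottoms (l : List ℕ) : Set ℕ :=
  {v | ∃ i x, l[i]? = some x ∧ l[i + 1]? = some v ∧ v < x}

/-- The three set-valued statistics of a word. -/
def stats (l : List ℕ) : Set ℕ × Set ℕ × Set ℕ :=
  (records (· < ·) l, records (· > ·) l, descentBottoms l)

/-- The length of the initial ascending run. -/
def run : List ℕ → ℕ
  | [] => 0
  | [_] => 1
  | x :: y :: l => if y < x then 1 else run (y :: l) + 1

open Classical in
/-- The number of nonempty prefixes all of whose letters are below all later letters. -/
noncomputable def cuts (l : List ℕ) : ℕ :=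
  ((Finset.range l.length).filter fun k => Below (l.take (k + 1)) (l.drop (k + 1))).card

theorem Below.nil_right {α : Type*} [LT α] (l : List α) : Below l [] := by simp [Below]

theorem below_append_left {α : Type*} [LT α] {l m p : List α} :
    Below (l ++ m) p ↔ Below l p ∧ Below m p := by
  simp only [Below, List.mem_append]
  exact ⟨fun h => ⟨fun x hx => h x (.inl hx), fun x hx => h x (.inr hx)⟩,
    fun h x hx => hx.elim (h.1 x) (h.2 x)⟩

theorem below_append_right {α : Type*} [LT α] {l m p : List α} :
    Below l (m ++ p) ↔ Below l m ∧ Below l p := by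
  simp only [Below, List.mem_append]
  exact ⟨fun h => ⟨fun x hx y hy => h x hx y (.inl hy), fun x hx y hy => h x hx y (.inr hy)⟩,
    fun h x hx y hy => hy.elim (h.1 x hx y) (h.2 x hx y)⟩

theorem Below.append_left {α : Type*} [LT α] {l m p : List α} (h : Below l p) (h' : Below m p) :
    Below (l ++ m) p := below_append_left.2 ⟨h, h'⟩

theorem Below.append_right {α : Type*} [LT α] {l m p : List α} (h : Below l m) (h' : Below l p) :
    Below l (m ++ p) := below_append_right.2 ⟨h, h'⟩

/-- A direct cut makes the first letter smaller than the last, a skew cut makes it larger. -/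
theorem not_below_above {p q a b : List ℕ} (hp : p ≠ []) (hq : q ≠ []) (ha : a ≠ [])
    (hb : b ≠ []) (e : p ++ q = a ++ b) (h : Below p q) (h' : Below b a) : False := by
  have h1 := congrArg List.head? e
  have h2 := congrArg List.getLast? e
  rw [List.head?_append_of_ne_nil _ hp, List.head?_append_of_ne_nil _ ha,
    List.head?_eq_some_head hp, List.head?_eq_some_head ha, Option.some_inj] at h1
  rw [List.getLast?_append_of_ne_nil _ hq, List.getLast?_append_of_ne_nil _ hb,
    List.getLast?_eq_some_getLast hq, List.getLast?_eq_some_getLast hb, Option.some_inj] at h2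
  have h3 := h _ (List.head_mem hp) _ (List.getLast_mem hq)
  have h4 := h' _ (List.getLast_mem hb) _ (List.head_mem ha)
  rw [h1, h2] at h3
  exact lt_asymm h3 h4

theorem mem_records_append {r : ℕ → ℕ → Prop} {l m : List ℕ} {v : ℕ} :
    v ∈ records r (l ++ m) ↔ v ∈ records r l ∨ (v ∈ records r m ∧ ∀ x ∈ l, r x v) := by
  simp only [records, Set.mem_ofPred_eq]
  constructor
  · rintro ⟨i, hi, h⟩
    rcases lt_or_ge i l.length with hl | hl
    · rw [List.getElem?_append_left hl] at hi
      rw [List.take_append_of_le_length hl.le] at h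
      exact .inl ⟨i, hi, h⟩
    · rw [List.getElem?_append_right hl] at hi
      rw [List.take_append, List.take_of_length_le hl] at h
      exact .inr ⟨⟨_, hi, fun x hx => h x (List.mem_append_right _ hx)⟩,
        fun x hx => h x (List.mem_append_left _ hx)⟩
  · rintro (⟨i, hi, h⟩ | ⟨⟨i, hi, h⟩, h'⟩)
    · have hl : i < l.length := (List.getElem?_eq_some_iff.1 hi).1
      refine ⟨i, by rwa [List.getElem?_append_left hl], ?_⟩
      rwa [List.take_append_of_le_length hl.le]
    · refine ⟨l.length + i, by simpa [List.getElem?_append_right] using hi, fun x hx => ?_⟩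
      rw [List.take_append, List.take_of_length_le (by omega)] at hx
      rcases List.mem_append.1 hx with hx | hx
      · exact h' x hx
      · exact h x (by simpa using hx)

theorem mem_of_mem_records {r : ℕ → ℕ → Prop} {l : List ℕ} {v : ℕ} (h : v ∈ records r l) :
    v ∈ l := by
  obtain ⟨i, hi, -⟩ := h
  exact List.mem_of_getElem? hi

theorem mem_descentBottoms_append {l m : List ℕ} {v : ℕ} :
    v ∈ descentBottoms (l ++ m) ↔ v ∈ descentBottoms l ∨ v ∈ descentBottoms m ∨
      ∃ x, l.getLast? = some x ∧ m.head? = some v ∧ v < x := by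
  simp only [descentBottoms, Set.mem_ofPred_eq]
  constructor
  · rintro ⟨i, x, hi, hv, h⟩
    rcases lt_trichotomy (i + 1) l.length with hl | hl | hl
    · rw [List.getElem?_append_left (by omega)] at hi hv
      exact .inl ⟨i, x, hi, hv, h⟩
    · rw [List.getElem?_append_left (by omega)] at hi
      rw [List.getElem?_append_right (by omega), hl, Nat.sub_self] at hv
      refine .inr (.inr ⟨x, ?_, by rwa [List.head?_eq_getElem?], h⟩)
      rw [List.getLast?_eq_getElem?, ← hl]
      exact hi
    · rw [List.getElem?_append_right (by omega)] at hi hv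
      refine .inr (.inl ⟨i - l.length, x, hi, ?_, h⟩)
      rwa [Nat.sub_add_comm (by omega)] at hv
  · rintro (⟨i, x, hi, hv, h⟩ | ⟨i, x, hi, hv, h⟩ | ⟨x, hx, hv, h⟩)
    · have h1 : i + 1 < l.length := (List.getElem?_eq_some_iff.1 hv).1
      exact ⟨i, x, by rwa [List.getElem?_append_left (by omega)],
        by rwa [List.getElem?_append_left (by omega)], h⟩
    · refine ⟨l.length + i, x, ?_, ?_, h⟩
      · simpa [List.getElem?_append_right] using hi
      · rw [List.getElem?_append_right (by omega), add_assoc, Nat.add_sub_cancel_left]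
        exact hv
    · have hl : l.length ≠ 0 := by
        rintro h0
        rw [List.length_eq_zero_iff.1 h0] at hx
        simp at hx
      refine ⟨l.length - 1, x, ?_, ?_, h⟩
      · rw [List.getElem?_append_left (by omega), ← List.getLast?_eq_getElem?]
        exact hx
      · rw [List.getElem?_append_right (by omega), ← hv, List.head?_eq_getElem?]
        congr 1
        omega

theorem mem_descentBottoms_append_of_below {l m : List ℕ} {v : ℕ} (h : Below l m) :
    v ∈ descentBottoms (l ++ m) ↔ v ∈ descentBottoms l ∨ v ∈ descentBottoms m := by
  rw [mem_descentBottoms_append]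
  refine or_congr_right (or_iff_left ?_)
  rintro ⟨x, hx, hv, hlt⟩
  exact lt_asymm hlt (h x (List.mem_of_getLast? hx) v (List.mem_of_head? hv))

theorem mem_records_lt_append_of_below {l m : List ℕ} {v : ℕ} (h : Below l m) :
    v ∈ records (· < ·) (l ++ m) ↔ v ∈ records (· < ·) l ∨ v ∈ records (· < ·) m := by
  rw [mem_records_append]
  exact or_congr_right (and_iff_left_of_imp fun hv x hx => h x hx v (mem_of_mem_records hv))

theorem mem_records_gt_append_of_below {l m : List ℕ} {v : ℕ} (h : Below l m) (hl : l ≠ []) :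
    v ∈ records (· > ·) (l ++ m) ↔ v ∈ records (· > ·) l := by
  rw [mem_records_append]
  refine or_iff_left ?_
  rintro ⟨hv, hx⟩
  exact lt_asymm (hx _ (List.head_mem hl)) (h _ (List.head_mem hl) v (mem_of_mem_records hv))

theorem mem_records_lt_append_of_above {l m : List ℕ} {v : ℕ} (h : Below m l) (hl : l ≠ []) :
    v ∈ records (· < ·) (l ++ m) ↔ v ∈ records (· < ·) l := by
  rw [mem_records_append]
  refine or_iff_left ?_
  rintro ⟨hv, hx⟩
  exact lt_asymm (hx _ (List.head_mem hl)) (h v (mem_of_mem_records hv) _ (List.head_mem hl))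

theorem mem_records_gt_append_of_above {l m : List ℕ} {v : ℕ} (h : Below m l) :
    v ∈ records (· > ·) (l ++ m) ↔ v ∈ records (· > ·) l ∨ v ∈ records (· > ·) m := by
  rw [mem_records_append]
  exact or_congr_right (and_iff_left_of_imp fun hv x hx => h v (mem_of_mem_records hv) x hx)

theorem mem_descentBottoms_append_of_above {l m : List ℕ} {v : ℕ} (h : Below m l) (hl : l ≠ []) :
    v ∈ descentBottoms (l ++ m) ↔
      v ∈ descentBottoms l ∨ v ∈ descentBottoms m ∨ m.head? = some v := by
  rw [mem_descentBottoms_append]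
  refine or_congr_right (or_congr_right ⟨fun ⟨_, _, h, _⟩ => h, fun hv => ?_⟩)
  exact ⟨_, List.getLast?_eq_some_getLast hl, hv,
    h v (List.mem_of_head? hv) _ (List.getLast_mem hl)⟩

/-- The set-valued statistics of `(a ⊖ b) ⊕ c` in terms of those of `a ⊕ c` and `b`. -/
theorem stats_skew {a b c : List ℕ} (ha : a ≠ []) (hba : Below b a) (hac : Below a c)
    (hbc : Below b c) :
    stats (a ++ b ++ c) = ((stats (a ++ c)).1, (stats (a ++ c)).2.1 ∪ (stats b).2.1,
      (stats (a ++ c)).2.2 ∪ (stats b).2.2 ∪ {v | b.head? = some v}) := by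
  have hab : a ++ b ≠ [] := by simp [ha]
  have h := hac.append_left hbc
  refine Prod.ext ?_ (Prod.ext ?_ ?_) <;> ext v <;>
    simp only [stats, Set.mem_union, Set.mem_ofPred_eq]
  · rw [mem_records_lt_append_of_below h, mem_records_lt_append_of_below hac,
      mem_records_lt_append_of_above hba ha]
  · rw [mem_records_gt_append_of_below h hab, mem_records_gt_append_of_below hac ha,
      mem_records_gt_append_of_above hba]
  · rw [mem_descentBottoms_append_of_below h, mem_descentBottoms_append_of_below hac,
      mem_descentBottoms_append_of_above hba ha]
    tauto

theorem stats_append {a c : List ℕ} (ha : a ≠ []) (hac : Below a c) :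
    stats (a ++ c) = ((stats a).1 ∪ (stats c).1, (stats a).2.1,
      (stats a).2.2 ∪ (stats c).2.2) := by
  refine Prod.ext ?_ (Prod.ext ?_ ?_) <;> ext v <;>
    simp only [stats, Set.mem_union]
  · exact mem_records_lt_append_of_below hac
  · exact mem_records_gt_append_of_below hac ha
  · exact mem_descentBottoms_append_of_below hac

theorem run_append_of_above {l m : List ℕ} (hl : l ≠ []) (hm : m ≠ []) (h : Below m l)
    (c : List ℕ) : run (l ++ m ++ c) = run l := by
  induction l with
  | nil => exact absurd rfl hl
  | cons x l ih =>
    cases l with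
    | nil =>
      cases m with
      | nil => exact absurd rfl hm
      | cons y m =>
        have := h y (by simp) x (by simp)
        simp [run, this]
    | cons y l =>
      have := ih (by simp) fun u hu v hv => h u hu v (List.mem_cons_of_mem _ hv)
      simp only [List.cons_append, run] at this ⊢
      rw [this]

theorem run_cons {x : ℕ} {l : List ℕ} (h : Below [x] l) : run (x :: l) = run l + 1 := by
  cases l with
  | nil => rfl
  | cons y l => simp [run, (h x (by simp) y (by simp)).le]

theorem cuts_append {l m : List ℕ} (h : Below l m) : cuts (l ++ m) = cuts l + cuts m := by
  classical
  simp only [cuts, Finset.card_filter, List.length_append]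
  -- cuts inside `l` and cuts inside `m` are counted separately
  rw [Finset.sum_range_add]
  congr 1
  · refine Finset.sum_congr rfl fun k hk => ?_
    have hk : k + 1 ≤ l.length := Finset.mem_range.1 hk
    congr 1
    rw [List.take_append_of_le_length hk, List.drop_append_of_le_length hk, below_append_right]
    exact propext (and_iff_left fun x hx => h x (List.mem_of_mem_take hx))
  · refine Finset.sum_congr rfl fun k hk => ?_
    congr 1
    rw [List.take_append, List.drop_append, List.take_of_length_le (by omega),
      List.drop_of_length_le (by omega), List.nil_append, below_append_left, add_assoc,
      Nat.add_sub_cancel_left]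
    exact propext (and_iff_right fun x hx y hy => h x hx y (List.mem_of_mem_drop hy))

theorem cuts_skew {l m : List ℕ} (hl : l ≠ []) (hm : m ≠ []) (h : Below m l) :
    cuts (l ++ m) = 1 := by
  classical
  have hpos : 0 < (l ++ m).length := by
    have := List.length_pos_iff.2 hl
    rw [List.length_append]
    omega
  rw [cuts, Finset.card_eq_one]
  refine ⟨(l ++ m).length - 1, ?_⟩
  ext k
  simp only [Finset.mem_filter, Finset.mem_range, Finset.mem_singleton]
  constructor
  · rintro ⟨hk, hb⟩
    by_contra hne
    refine not_below_above ?_ ?_ hl hm (List.take_append_drop (k + 1) (l ++ m)) hb h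
    · rw [← List.length_pos_iff, List.length_take]
      omega
    · rw [← List.length_pos_iff, List.length_drop]
      omega
  · rintro rfl
    refine ⟨by omega, ?_⟩
    rw [List.drop_of_length_le (by omega)]
    exact Below.nil_right _

/-! ### The word of a tree -/

/-- The permutation encoded by a tree, written as a word with the letters
`s, s + 1, …, s + size - 1`. -/
def word : ℕ → SepTree → List ℕ
  | _, nil => []
  | s, one r => s :: word (s + 1) r
  | s, minus a b r => word (s + b.size) a ++ word s b ++ word (s + a.size + b.size) r

theorem length_word (s : ℕ) (t : SepTree) : (word s t).length = t.size := by
  induction t generalizing s with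
  | nil => rfl
  | one r ih => simp [word, size, ih]
  | minus a b r iha ihb ihr => simp [word, size, iha, ihb, ihr]; omega

theorem word_app (s : ℕ) (t u : SepTree) :
    word s (t.app u) = word s t ++ word (s + t.size) u := by
  induction t generalizing s with
  | nil => simp [word, app, size]
  | one r ih =>
    simp only [word, app, ih, size, List.cons_append]
    rw [add_assoc, add_comm 1]
  | minus a b r _ _ ih =>
    simp only [word, app, ih, size, List.append_assoc]
    rw [show s + a.size + b.size + r.size = s + (a.size + b.size + r.size) by ring]

theorem word_perm (s : ℕ) (t : SepTree) : (word s t).Perm (List.range' s t.size) := by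
  induction t generalizing s with
  | nil => simp [word, size]
  | one r ih =>
    rw [word, size, List.range'_succ]
    exact (ih (s + 1)).cons s
  | minus a b r iha ihb ihr =>
    have h : List.range' s (minus a b r).size = List.range' s b.size ++
        List.range' (s + b.size) a.size ++ List.range' (s + a.size + b.size) r.size := by
      rw [List.range'_append_1, add_right_comm, add_assoc s, List.range'_append_1, size]
      congr 1
      omega
    rw [h, word]
    exact ((List.perm_append_comm.trans ((ihb _).append (iha _)))).append (ihr _)

theorem mem_word {s x : ℕ} {t : SepTree} : x ∈ word s t ↔ s ≤ x ∧ x < s + t.size := by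
  rw [(word_perm s t).mem_iff, List.mem_range'_1]

theorem word_below {s s' : ℕ} {t u : SepTree} (h : s + t.size ≤ s') :
    Below (word s t) (word s' u) := by
  intro x hx y hy
  rw [mem_word] at hx hy
  omega

theorem word_ne_nil {s : ℕ} {t : SepTree} (ht : t.Valid) (h : t ≠ nil) : word s t ≠ [] := by
  rw [← List.length_pos_iff, length_word]
  exact size_pos ht h

theorem run_word {t : SepTree} (ht : t.Valid) (s : ℕ) : run (word s t) = t.iar := by
  induction t generalizing s with
  | nil => rfl
  | one r ih =>
    rw [word, run_cons, ih ht, iar]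
    intro x hx y hy
    rw [mem_word] at hy
    have := List.mem_singleton.1 hx
    omega
  | minus a b r iha _ _ =>
    obtain ⟨ha, hb, hr, hne, hi⟩ := ht
    rw [word, run_append_of_above (word_ne_nil ha hne) (word_ne_nil hb hi.ne_nil)
      (word_below le_rfl), iha ha, iar]

theorem cuts_word {t : SepTree} (ht : t.Valid) (s : ℕ) : cuts (word s t) = t.comp := by
  induction t generalizing s with
  | nil => rw [word, cuts, List.length_nil, Finset.range_zero, Finset.filter_empty]; rfl
  | one r ih =>
    have hc : cuts [s] = 1 := by
      simp [cuts, Below]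
    rw [word, ← List.singleton_append, cuts_append, ih ht, comp, hc, add_comm]
    intro x hx y hy
    rw [mem_word] at hy
    have := List.mem_singleton.1 hx
    omega
  | minus a b r _ _ ih =>
    obtain ⟨ha, hb, hr, hne, hi⟩ := ht
    rw [word, cuts_append, ih hr,
      cuts_skew (word_ne_nil ha hne) (word_ne_nil hb hi.ne_nil) (word_below le_rfl), comp, add_comm]
    exact (word_below (by omega)).append_left (word_below (by omega))

/-- Equal length and equal set-valued statistics, for all offsets of the letters. -/
def Same (t u : SepTree) : Prop :=
  t.size = u.size ∧ ∀ s, stats (word s t) = stats (word s u)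

theorem Same.refl (t : SepTree) : Same t t := ⟨rfl, fun _ => rfl⟩

theorem Same.symm {t u : SepTree} (h : Same t u) : Same u t := ⟨h.1.symm, fun s => (h.2 s).symm⟩

theorem Same.trans {t u v : SepTree} (h : Same t u) (h' : Same u v) : Same t v :=
  ⟨h.1.trans h'.1, fun s => (h.2 s).trans (h'.2 s)⟩

theorem Same.app {t t' u u' : SepTree} (ht : Same t t') (hu : Same u u') :
    Same (t.app u) (t'.app u') := by
  refine ⟨by rw [size_app, size_app, ht.1, hu.1], fun s => ?_⟩
  rw [word_app, word_app]
  by_cases h0 : t.size = 0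
  · have h0' : t'.size = 0 := ht.1 ▸ h0
    have e := List.length_eq_zero_iff.1 ((length_word s t).trans h0)
    have e' := List.length_eq_zero_iff.1 ((length_word s t').trans h0')
    rw [e, e', h0, h0']
    exact hu.2 s
  · have h0' : t'.size ≠ 0 := ht.1 ▸ h0
    rw [stats_append _ (word_below le_rfl), stats_append _ (word_below le_rfl), ht.2, hu.2, ht.1]
    · rwa [Ne, ← List.length_eq_zero_iff, length_word]
    · rwa [Ne, ← List.length_eq_zero_iff, length_word]

theorem Same.one {r r' : SepTree} (h : Same r r') : Same (one r) (one r') :=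
  (Same.refl (.one nil)).app h

theorem stats_word_minus {a : SepTree} (ha : a.Valid) (hne : a ≠ nil) (b r : SepTree) (s : ℕ) :
    stats (word s (minus a b r)) =
      ((stats (word (s + b.size) (a.app r))).1,
        (stats (word (s + b.size) (a.app r))).2.1 ∪ (stats (word s b)).2.1,
        (stats (word (s + b.size) (a.app r))).2.2 ∪ (stats (word s b)).2.2 ∪
          {v | (word s b).head? = some v}) := by
  rw [word_app, add_right_comm s, word]
  exact stats_skew (word_ne_nil ha hne) (word_below le_rfl) (word_below (by omega))
    (word_below (by omega))

/-- For fixed `b`, the set-valued statistics of `(a ⊖ b) ⊕ r` depend on `a` and `r` only through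
`a ⊕ r`. -/
theorem Same.minus {a a' r r' : SepTree} (b : SepTree) (ha : a.Valid) (hne : a ≠ nil)
    (ha' : a'.Valid) (hne' : a' ≠ nil) (h : Same (a.app r) (a'.app r')) :
    Same (minus a b r) (minus a' b r') := by
  refine ⟨?_, fun s => ?_⟩
  · have := h.1
    rw [size_app, size_app] at this
    simp only [size]
    omega
  · rw [stats_word_minus ha hne, stats_word_minus ha' hne', h.2]

theorem theta_same {t : SepTree} (ht : t.Valid) : Same t.theta t := by
  induction t with
  | nil => exact .refl _
  | one r ih => exact (ih ht).one
  | minus a b r iha _ _ =>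
    have hv := theta_valid ht
    obtain ⟨ha, hb, hr, hne, hi⟩ := ht
    refine Same.minus b hv.1 hv.2.2.2.1 ha hne ?_
    rw [take_app_drop]
    exact (iha ha).app (.refl r)

theorem thetaInv_same {t : SepTree} (ht : t.Valid) : Same t.thetaInv t := by
  have h := theta_same (thetaInv_valid ht)
  rw [theta_thetaInv ht] at h
  exact h.symm

theorem swap_same {t : SepTree} (ht : t.Valid) : Same t.swap t := by
  induction t with
  | nil => exact .refl _
  | one r ih => exact (ih ht).one
  | minus a b r _ _ _ =>
    have hv := swap_valid ht
    obtain ⟨ha, hb, hr, hne, hi⟩ := ht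
    refine Same.minus b hv.1 hv.2.2.2.1 ha hne ?_
    have h := (thetaInv_same (valid_take_drop (r.comp + 1)
      (valid_app.2 ⟨theta_valid ha, hr⟩)).1).app (.refl (drop (r.comp + 1) (a.theta.app r)))
    rw [take_app_drop] at h
    exact h.trans ((theta_same ha).app (.refl r))

/-! ### Uniqueness of the decomposition -/

theorem eq_nil_of_skew_split {b : SepTree} (hb : b.Valid) (hi : b.SkewIndec) {s : ℕ}
    {x y : List ℕ} (e : word s b = x ++ y) (h : Below y x) : x = [] ∨ y = [] := by
  by_contra! hne
  obtain ⟨hx, hy⟩ := hne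
  cases b with
  | nil => exact hi
  | one r =>
    by_cases hr : r = nil
    · subst hr
      have := congrArg List.length e
      have h1 := List.length_pos_iff.2 hx
      have h2 := List.length_pos_iff.2 hy
      simp only [word, List.length_cons, List.length_nil, List.length_append] at this
      omega
    · refine not_below_above (p := [s]) (q := word (s + 1) r) (by simp)
        (word_ne_nil (t := r) hb hr) hx hy e (fun u hu v hv => ?_) h
      have := List.mem_singleton.1 hu
      have := (mem_word.1 hv).1
      omega
  | minus a c r =>
    have hr : r ≠ nil := by rintro rfl; exact hi
    refine not_below_above ?_ (word_ne_nil hb.2.2.1 hr) hx hy e ?_ h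
    · exact List.append_ne_nil_of_left_ne_nil (word_ne_nil hb.1 hb.2.2.2.1) _
    · exact (word_below (by omega)).append_left (word_below (by omega))

/-- In two decompositions of the same word with each first part skew decomposable, the first
parts agree. -/
theorem direct_prefix_unique {a b c a' b' c' : List ℕ} (ha : a ≠ []) (hb : b ≠ [])
    (hba : Below b a) (hc : Below (a ++ b) c) (ha' : a' ≠ []) (hb' : b' ≠ []) (hba' : Below b' a')
    (hc' : Below (a' ++ b') c') (e : a ++ b ++ c = a' ++ b' ++ c') :
    a ++ b = a' ++ b' ∧ c = c' := by
  have hab : a ++ b ≠ [] := List.append_ne_nil_of_left_ne_nil ha _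
  have hab' : a' ++ b' ≠ [] := List.append_ne_nil_of_left_ne_nil ha' _
  rcases List.append_eq_append_iff.1 e with ⟨x, hx, hx'⟩ | ⟨x, hx, hx'⟩
  · by_cases h : x = []
    · subst h; simp_all
    · refine (not_below_above hab h ha' hb' hx.symm ?_ hba').elim
      rw [hx'] at hc
      exact (below_append_right.1 hc).1
  · by_cases h : x = []
    · subst h; simp_all
    · refine (not_below_above hab' h ha hb hx.symm ?_ hba).elim
      rw [hx'] at hc'
      exact (below_append_right.1 hc').1

/-- The last skew component is unique. -/
theorem skew_suffix_unique {a a' : List ℕ} {b b' : SepTree} {s : ℕ} (hb : b.Valid)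
    (hi : b.SkewIndec) (hb' : b'.Valid) (hi' : b'.SkewIndec) (h : Below (word s b) a)
    (h' : Below (word s b') a') (e : a ++ word s b = a' ++ word s b') :
    a = a' ∧ word s b = word s b' := by
  rcases List.append_eq_append_iff.1 e with ⟨x, hx, hx'⟩ | ⟨x, hx, hx'⟩
  · have hn : x = [] := by
      refine (eq_nil_of_skew_split hb hi hx' ?_).resolve_right (word_ne_nil hb' hi'.ne_nil)
      rw [hx] at h'
      exact (below_append_right.1 h').2
    subst hn; simp_all
  · have hn : x = [] := by
      refine (eq_nil_of_skew_split hb' hi' hx' ?_).resolve_right (word_ne_nil hb hi.ne_nil)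
      rw [hx] at h
      exact (below_append_right.1 h).2
    subst hn; simp_all

theorem word_one_ne_word_minus {a b : SepTree} (r r' : SepTree) (s : ℕ) (ha : a.Valid)
    (hne : a ≠ nil) (hb : b.Valid) (hi : b.SkewIndec) :
    word s (one r) ≠ word s (minus a b r') := by
  intro e
  have h := congrArg List.head? e
  have hw := word_ne_nil (s := s + b.size) ha hne
  rw [word, word, List.append_assoc, List.head?_append_of_ne_nil _ hw,
    List.head?_eq_some_head hw, List.head?_cons, Option.some_inj] at h
  have h1 := (mem_word.1 (List.head_mem hw)).1
  have h2 := size_pos hb hi.ne_nil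
  omega

theorem word_injective {t u : SepTree} (ht : t.Valid) (hu : u.Valid) {s : ℕ}
    (e : word s t = word s u) : t = u := by
  induction t generalizing u s with
  | nil =>
    by_contra h
    exact word_ne_nil hu (Ne.symm h) e.symm
  | one r ih =>
    cases u with
    | nil => exact absurd e (by simp [word])
    | one r' => rw [ih (u := r') ht hu (List.cons.inj e).2]
    | minus a b r' =>
      exact absurd e (word_one_ne_word_minus r r' s hu.1 hu.2.2.2.1 hu.2.1 hu.2.2.2.2)
  | minus a b r iha ihb ihr =>
    obtain ⟨ha, hb, hr, hne, hi⟩ := ht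
    cases u with
    | nil => exact absurd e (word_ne_nil ⟨ha, hb, hr, hne, hi⟩ (by simp))
    | one r' => exact absurd e.symm (word_one_ne_word_minus r' r s ha hne hb hi)
    | minus a' b' r' =>
      obtain ⟨ha', hb', hr', hne', hi'⟩ := hu
      obtain ⟨h1, h2⟩ := direct_prefix_unique (word_ne_nil ha hne) (word_ne_nil hb hi.ne_nil)
        (word_below le_rfl) ((word_below (by omega)).append_left (word_below (by omega)))
        (word_ne_nil ha' hne') (word_ne_nil hb' hi'.ne_nil) (word_below le_rfl)
        ((word_below (by omega)).append_left (word_below (by omega))) e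
      obtain ⟨h3, h4⟩ := skew_suffix_unique hb hi hb' hi' (word_below le_rfl) (word_below le_rfl) h1
      obtain rfl := ihb hb hb' h4
      obtain rfl := iha ha ha' h3
      obtain rfl := ihr hr hr' h2
      rfl

/-! ### Pattern avoidance for words -/

/-- No subsequence of the word is order isomorphic to `3142` or `2413`. -/
def Separable {α : Type*} [LinearOrder α] (l : List α) : Prop :=
  ∀ a b c d, [a, b, c, d].Sublist l → ¬(b < d ∧ d < a ∧ a < c) ∧ ¬(c < a ∧ a < d ∧ d < b)

/-- No subsequence of the word is order isomorphic to `312`. -/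
def Avoids312 (l : List ℕ) : Prop := ∀ a b c, [a, b, c].Sublist l → ¬(b < c ∧ c < a)

theorem Separable.sublist {α : Type*} [LinearOrder α] {l m : List α} (h : Separable m)
    (hl : l.Sublist m) : Separable l := fun a b c d hs => h a b c d (hs.trans hl)

theorem Avoids312.sublist {l m : List ℕ} (h : Avoids312 m) (hl : l.Sublist m) : Avoids312 l :=
  fun a b c hs => h a b c (hs.trans hl)

theorem Separable.dual {α : Type*} [LinearOrder α] {l : List α} (h : Separable l) :
    @Separable αᵒᵈ _ l := by
  intro a b c d hs
  obtain ⟨h1, h2⟩ := h a b c d hs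
  exact ⟨fun ⟨x, y, z⟩ => h2 ⟨z, y, x⟩, fun ⟨x, y, z⟩ => h1 ⟨z, y, x⟩⟩

theorem Below.dual {α : Type*} [LinearOrder α] {l m : List α} (h : Below l m) :
    @Below αᵒᵈ _ m l := fun x hx y hy => h y hy x hx

theorem Separable.append {α : Type*} [LinearOrder α] {l m : List α} (hl : Separable l)
    (hm : Separable m) (h : Below l m) : Separable (l ++ m) := by
  intro a b c d hs
  obtain ⟨p, q, e, hp, hq⟩ := List.sublist_append_iff.1 hs
  have key : ∀ x ∈ p, ∀ y ∈ q, x < y := fun x hx y hy => h x (hp.subset hx) y (hq.subset hy)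
  rcases p with _ | ⟨a', _ | ⟨b', _ | ⟨c', _ | ⟨d', p⟩⟩⟩⟩
  · rw [List.nil_append] at e
    exact hm a b c d (e ▸ hq)
  · simp only [List.cons_append, List.nil_append, List.cons.injEq] at e
    obtain ⟨rfl, rfl⟩ := e
    have h1 := key a (by simp) b (by simp)
    have h2 := key a (by simp) c (by simp)
    have h3 := key a (by simp) d (by simp)
    exact ⟨fun ⟨_, x, _⟩ => lt_asymm x h3, fun ⟨x, _, _⟩ => lt_asymm x h2⟩
  · simp only [List.cons_append, List.nil_append, List.cons.injEq] at e
    obtain ⟨rfl, rfl, rfl⟩ := e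
    have h1 := key a (by simp) c (by simp)
    have h2 := key a (by simp) d (by simp)
    exact ⟨fun ⟨_, x, _⟩ => lt_asymm x h2, fun ⟨x, _, _⟩ => lt_asymm x h1⟩
  · simp only [List.cons_append, List.nil_append, List.cons.injEq] at e
    obtain ⟨rfl, rfl, rfl, rfl⟩ := e
    have h1 := key a (by simp) d (by simp)
    have h2 := key b (by simp) d (by simp)
    exact ⟨fun ⟨_, x, _⟩ => lt_asymm x h1, fun ⟨_, _, x⟩ => lt_asymm x h2⟩
  · simp only [List.cons_append, List.cons.injEq] at e
    obtain ⟨rfl, rfl, rfl, rfl, e⟩ := e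
    have : p = [] := (List.append_eq_nil_iff.1 e.symm).1
    subst this
    exact hl _ _ _ _ hp

theorem Separable.append_above {α : Type*} [LinearOrder α] {l m : List α} (hl : Separable l)
    (hm : Separable m) (h : Below m l) : Separable (l ++ m) :=
  Separable.dual (α := αᵒᵈ) (Separable.append (α := αᵒᵈ) hl.dual hm.dual h.dual)

theorem separable_word (s : ℕ) (t : SepTree) : Separable (word s t) := by
  induction t generalizing s with
  | nil => intro a b c d hs; simp [word] at hs
  | one r ih =>
    rw [word, ← List.singleton_append]
    refine Separable.append (fun a b c d hs => ?_) (ih _) fun x hx y hy => ?_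
    · have := hs.length_le
      simp at this
    · have := List.mem_singleton.1 hx
      have := (mem_word.1 hy).1
      omega
  | minus a b r iha ihb ihr =>
    exact ((iha _).append_above (ihb _) (word_below le_rfl)).append (ihr _)
      ((word_below (by omega)).append_left (word_below (by omega)))

theorem Avoids312.append {l m : List ℕ} (hl : Avoids312 l) (hm : Avoids312 m) (h : Below l m) :
    Avoids312 (l ++ m) := by
  intro a b c hs
  obtain ⟨p, q, e, hp, hq⟩ := List.sublist_append_iff.1 hs
  have key : ∀ x ∈ p, ∀ y ∈ q, x < y := fun x hx y hy => h x (hp.subset hx) y (hq.subset hy)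
  rcases p with _ | ⟨a', _ | ⟨b', _ | ⟨c', p⟩⟩⟩
  · rw [List.nil_append] at e
    exact hm a b c (e ▸ hq)
  · simp only [List.cons_append, List.nil_append, List.cons.injEq] at e
    obtain ⟨rfl, rfl⟩ := e
    have h1 := key a (by simp) c (by simp)
    exact fun ⟨_, x⟩ => lt_asymm x h1
  · simp only [List.cons_append, List.nil_append, List.cons.injEq] at e
    obtain ⟨rfl, rfl, rfl⟩ := e
    have h1 := key a (by simp) c (by simp)
    exact fun ⟨_, x⟩ => lt_asymm x h1
  · simp only [List.cons_append, List.cons.injEq] at e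
    obtain ⟨rfl, rfl, rfl, e⟩ := e
    have : p = [] := (List.append_eq_nil_iff.1 e.symm).1
    subst this
    exact hl _ _ _ hp

theorem Avoids312.append_singleton {l : List ℕ} {s : ℕ} (hl : Avoids312 l)
    (h : Below [s] l) : Avoids312 (l ++ [s]) := by
  intro a b c hs
  obtain ⟨p, q, e, hp, hq⟩ := List.sublist_append_iff.1 hs
  rcases q with _ | ⟨c', q⟩
  · rw [List.append_nil] at e
    exact hl a b c (e ▸ hp)
  · have hc : q = [] := List.length_eq_zero_iff.1 (by have := hq.length_le; simpa using this)
    subst hc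
    obtain ⟨h1, h2⟩ := List.append_inj' (s₁ := [a, b]) (t₁ := [c]) e rfl
    subst h1
    obtain rfl := (List.cons.inj h2).1
    obtain rfl := List.mem_singleton.1 (hq.subset (List.mem_cons_self ..))
    have := h c (by simp) b (hp.subset (by simp))
    exact fun hbc => lt_asymm this hbc.1

theorem avoids312_word {t : SepTree} (ht : t.Simple) (s : ℕ) : Avoids312 (word s t) := by
  induction t generalizing s with
  | nil => intro a b c hs; simp [word] at hs
  | one r ih =>
    rw [word, ← List.singleton_append]
    refine Avoids312.append (fun a b c hs => ?_) (ih ht _) fun x hx y hy => ?_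
    · have := hs.length_le
      simp at this
    · have := List.mem_singleton.1 hx
      have := (mem_word.1 hy).1
      omega
  | minus a b r iha _ ihr =>
    obtain ⟨ha, rfl, hr⟩ := ht
    exact ((iha ha _).append_singleton (word_below (t := one nil) le_rfl)).append (ihr hr _)
      ((word_below (by omega)).append_left (word_below (t := one nil) (by simp [size])))

/-- A skew indecomposable permutation other than `1` is a direct sum of two nonempty ones, so it
contains the pattern `12`. -/
theorem exists_sublist_lt {b : SepTree} (hb : b.Valid) (hi : b.SkewIndec) (h : b ≠ one nil)
    (s : ℕ) : ∃ x y, x < y ∧ [x, y].Sublist (word s b) := by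
  cases b with
  | nil => exact hi.elim
  | one r =>
    have hr : r ≠ nil := by rintro rfl; exact h rfl
    have hw := word_ne_nil (s := s + 1) (t := r) hb hr
    refine ⟨s, (word (s + 1) r).head hw, (mem_word.1 (List.head_mem hw)).1, ?_⟩
    rw [word]
    exact (List.singleton_sublist.2 (List.head_mem hw)).cons_cons s
  | minus a c r =>
    have hr : r ≠ nil := by rintro rfl; exact hi
    have hw := word_ne_nil (s := s + a.size + c.size) hb.2.2.1 hr
    have hw' := word_ne_nil (s := s + c.size) hb.1 hb.2.2.2.1
    refine ⟨(word (s + c.size) a).head hw', (word (s + a.size + c.size) r).head hw, ?_, ?_⟩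
    · exact word_below (by omega) _ (List.head_mem hw') _ (List.head_mem hw)
    · exact (List.singleton_sublist.2 (List.mem_append_left _ (List.head_mem hw'))).append
        (List.singleton_sublist.2 (List.head_mem hw))

theorem simple_of_avoids312 {t : SepTree} (ht : t.Valid) {s : ℕ} (h : Avoids312 (word s t)) :
    t.Simple := by
  induction t generalizing s with
  | nil => trivial
  | one r ih => exact ih ht (h.sublist (List.sublist_cons_self s (word (s + 1) r)))
  | minus a b r iha _ ihr =>
    obtain ⟨ha, hb, hr, hne, hi⟩ := ht
    have hab := h.sublist (List.sublist_append_left _ _)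
    refine ⟨iha ha (hab.sublist (List.sublist_append_left _ _)), ?_,
      ihr hr (h.sublist (List.sublist_append_right _ _))⟩
    by_contra hb1
    obtain ⟨x, y, hxy, hs⟩ := exists_sublist_lt hb hi hb1 s
    have hw := word_ne_nil (s := s + b.size) ha hne
    refine hab _ x y ((List.singleton_sublist.2 (List.head_mem hw)).append hs) ⟨hxy, ?_⟩
    exact word_below le_rfl y (hs.subset (by simp)) _ (List.head_mem hw)

/-! ### Existence of the decomposition -/

/-- Appending a letter to a direct sum `p ⊕ q`: the letters of `p` below the new letter form a
prefix of `p`, as otherwise there is a `3142`; that prefix is split off, unless it is empty. -/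
theorem exists_split_of_below {α : Type*} [LinearOrder α] {p q : List α} {x : α} (hp : p ≠ [])
    (hq : q ≠ []) (h : Below p q) (hx : x ∉ p) (hs : Separable (p ++ q ++ [x])) :
    ∃ l m, l ≠ [] ∧ m ≠ [] ∧ p ++ q ++ [x] = l ++ m ∧ (Below l m ∨ Below m l) := by
  set l := p.takeWhile (· < x) with hl
  set u := p.dropWhile (· < x) with hu
  have e : l ++ u = p := List.takeWhile_append_dropWhile
  have hlx : ∀ y ∈ l, y < x := fun y hy => by simpa using List.mem_takeWhile_imp hy
  have hux : ∀ y ∈ u, x < y := by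
    intro y hy
    have hune : u ≠ [] := List.ne_nil_of_mem hy
    have hhead : x < u.head hune := by
      have h1 : ¬ u.head hune < x := by
        simpa using List.head_dropWhile_not (fun y => decide (y < x)) hune
      exact lt_of_le_of_ne (not_lt.1 h1) fun e' =>
        hx (e' ▸ e ▸ List.mem_append_right _ (List.head_mem hune))
    have hyx : y ≠ x := fun e' => hx (e' ▸ e ▸ List.mem_append_right _ hy)
    by_contra hlt
    have hlt : y < x := lt_of_le_of_ne (not_lt.1 hlt) hyx
    have hyt : y ∈ u.tail := by
      rw [← List.cons_head_tail hune] at hy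
      rcases List.mem_cons.1 hy with h' | h'
      · exact absurd hhead (h' ▸ lt_asymm hlt)
      · exact h'
    have hsub : [u.head hune, y].Sublist p := by
      rw [← e]
      refine List.Sublist.trans ?_ (List.sublist_append_right l u)
      conv_rhs => rw [← List.cons_head_tail hune]
      exact (List.singleton_sublist.2 hyt).cons_cons _
    -- the head of `u`, then `y`, a letter of `q`, and `x` form a `3142`
    have hpat := (hsub.append (List.singleton_sublist.2 (List.head_mem hq))).append
      (List.Sublist.refl [x])
    exact (hs _ _ _ _ hpat).1 ⟨hlt, hhead, h _ (hsub.subset (by simp)) _ (List.head_mem hq)⟩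
  by_cases hn : l = []
  · refine ⟨p ++ q, [x], by simp [hp], by simp, rfl, .inr ?_⟩
    rw [hn, List.nil_append] at e
    have hxp : ∀ y ∈ p, x < y := fun y hy => hux y (by rwa [e])
    intro y hy z hz
    obtain rfl := List.mem_singleton.1 hy
    rcases List.mem_append.1 hz with hz | hz
    · exact hxp z hz
    · exact (hxp _ (List.head_mem hp)).trans (h _ (List.head_mem hp) z hz)
  · refine ⟨l, u ++ q ++ [x], hn, by simp, by rw [← e]; simp, .inl ?_⟩
    refine Below.append_right (Below.append_right ?_ ?_) ?_
    · exact fun y hy z hz => (hlx y hy).trans (hux z hz)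
    · exact fun y hy z hz => h y (e ▸ List.mem_append_left _ hy) z hz
    · exact fun y hy z hz => List.mem_singleton.1 hz ▸ hlx y hy

/-- A separable word of length at least two is a direct or a skew sum. -/
theorem exists_split {α : Type*} [LinearOrder α] {l : List α} (hl : 2 ≤ l.length)
    (hn : l.Nodup) (hs : Separable l) :
    ∃ p q, p ≠ [] ∧ q ≠ [] ∧ l = p ++ q ∧ (Below p q ∨ Below q p) := by
  induction l using List.reverseRecOn with
  | nil => simp at hl
  | append_singleton l x ih =>
    have hxl : x ∉ l := fun hx => (List.nodup_append.1 hn).2.2 x hx x (by simp) rfl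
    rcases Nat.lt_or_ge l.length 2 with hlt | hge
    · obtain ⟨y, rfl⟩ : ∃ y, l = [y] := List.length_eq_one_iff.1 (by
        rw [List.length_append, List.length_singleton] at hl; omega)
      have hyx : y ≠ x := fun h => hxl (by simp [h])
      refine ⟨[y], [x], by simp, by simp, rfl, ?_⟩
      simpa [Below] using lt_or_gt_of_ne hyx
    · obtain ⟨p, q, hp, hq, rfl, h | h⟩ := ih hge (List.nodup_append.1 hn).1
        (hs.sublist (List.sublist_append_left _ _))
      · exact exists_split_of_below hp hq h (fun hx => hxl (List.mem_append_left _ hx)) hs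
      · -- reversing the order of the letters exchanges direct with skew sums and `3142` with `2413`
        obtain ⟨p', q', hp', hq', e, h'⟩ := exists_split_of_below (α := αᵒᵈ) hp hq h.dual
          (fun hx => hxl (List.mem_append_left _ hx)) hs.dual
        exact ⟨p', q', hp', hq', e, h'.symm.imp (fun h => Below.dual (α := αᵒᵈ) h)
          (fun h => Below.dual (α := αᵒᵈ) h)⟩

/-- The two parts of a direct sum are permutations of consecutive intervals. -/
theorem perm_range'_of_below {p q : List ℕ} {s n : ℕ} (h : Below p q)
    (hpq : (p ++ q).Perm (List.range' s n)) :
    p.Perm (List.range' s p.length) ∧ q.Perm (List.range' (s + p.length) q.length) := by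
  have hn : n = p.length + q.length := by simpa using hpq.length_eq.symm
  have hsort : (p.mergeSort ++ q.mergeSort).Pairwise (· ≤ ·) := by
    rw [List.pairwise_append]
    refine ⟨List.pairwise_mergeSort' _ _, List.pairwise_mergeSort' _ _, fun x hx y hy => ?_⟩
    exact (h x (List.mem_mergeSort.1 hx) y (List.mem_mergeSort.1 hy)).le
  have e : p.mergeSort ++ q.mergeSort =
      List.range' s p.length ++ List.range' (s + p.length) q.length := by
    rw [List.range'_append_1, ← hn]
    refine List.Perm.eq_of_pairwise' hsort ?_
      (((List.mergeSort_perm _ _).append (List.mergeSort_perm _ _)).trans hpq)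
    exact List.pairwise_le_range'
  obtain ⟨h1, h2⟩ := List.append_inj e (by simp)
  exact ⟨h1 ▸ (List.mergeSort_perm p _).symm, h2 ▸ (List.mergeSort_perm q _).symm⟩

/-- A skew sum of two encoded permutations is encoded: `a ⊖ (a' ⊖ b) = (a ⊖ a') ⊖ b`. -/
theorem exists_word_skew {b : SepTree} (hb : b.Valid) (hbne : b ≠ nil) {a : SepTree}
    (ha : a.Valid) (hne : a ≠ nil) (s : ℕ) :
    ∃ c : SepTree, c.Valid ∧ c ≠ nil ∧ word s c = word (s + b.size) a ++ word s b := by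
  have simple : b.SkewIndec →
      ∃ c : SepTree, c.Valid ∧ c ≠ nil ∧ word s c = word (s + b.size) a ++ word s b :=
    fun hi => ⟨minus a b nil, ⟨ha, hb, trivial, hne, hi⟩, by simp, by simp [word]⟩
  induction b generalizing s with
  | nil => exact absurd rfl hbne
  | one r => exact simple trivial
  | minus a' b' r iha _ _ =>
    cases r with
    | one r => exact simple trivial
    | minus a b r => exact simple trivial
    | nil =>
      obtain ⟨ha', hb', -, hne', hi'⟩ := hb
      obtain ⟨c, hc, hcne, e⟩ := iha ha' hne' (s + b'.size)
        fun hi => ⟨minus a a' nil, ⟨ha, ha', trivial, hne, hi⟩, by simp, by simp [word]⟩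
      refine ⟨minus c b' nil, ⟨hc, hb', trivial, hcne, hi'⟩, by simp, ?_⟩
      simp only [word, e, size, List.append_nil, List.append_assoc]
      congr 2
      omega

/-- Every separable permutation has a decomposition tree. -/
theorem exists_tree {s n : ℕ} {l : List ℕ} (hl : l.Perm (List.range' s n)) (hs : Separable l) :
    ∃ t : SepTree, t.Valid ∧ word s t = l := by
  induction n using Nat.strong_induction_on generalizing s l with
  | _ n ih =>
    have hlen : l.length = n := by simpa using hl.length_eq
    rcases n with _ | _ | n
    · exact ⟨nil, trivial, (List.length_eq_zero_iff.1 hlen).symm⟩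
    · refine ⟨one nil, trivial, ?_⟩
      rw [List.range'_one, List.perm_singleton] at hl
      exact hl.symm
    · obtain ⟨p, q, hp, hq, rfl, h | h⟩ :=
        exists_split (by omega) (hl.nodup_iff.2 List.nodup_range') hs
      all_goals
        have hp0 := List.length_pos_iff.2 hp
        have hq0 := List.length_pos_iff.2 hq
        have hsp := hs.sublist (List.sublist_append_left p q)
        have hsq := hs.sublist (List.sublist_append_right p q)
        rw [List.length_append] at hlen
      · obtain ⟨h1, h2⟩ := perm_range'_of_below h hl
        obtain ⟨t, ht, rfl⟩ := ih _ (by omega) h1 hsp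
        obtain ⟨u, hu, hu'⟩ := ih _ (by omega) h2 hsq
        refine ⟨t.app u, valid_app.2 ⟨ht, hu⟩, ?_⟩
        rw [word_app, ← hu', length_word]
      · obtain ⟨h1, h2⟩ := perm_range'_of_below h (List.perm_append_comm.trans hl)
        obtain ⟨b, hb, rfl⟩ := ih _ (by omega) h1 hsq
        obtain ⟨a, ha, rfl⟩ := ih _ (by omega) h2 hsp
        rw [length_word]
        obtain ⟨c, hc, -, e⟩ := exists_word_skew hb (by rintro rfl; exact hq rfl) ha
          (by rintro rfl; exact hp rfl) s
        exact ⟨c, hc, e⟩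

/-! ### Permutations as words -/

open PermStat

variable {n : ℕ}

/-- The one-line notation of a permutation, with letters `1, …, n`. -/
def letters (π : Equiv.Perm (Fin n)) : List ℕ := List.ofFn (letter π)

theorem letter_injective (π : Equiv.Perm (Fin n)) : Function.Injective (letter π) := by
  intro i j h
  exact π.injective (Fin.ext (Nat.succ_injective h))

theorem length_letters (π : Equiv.Perm (Fin n)) : (letters π).length = n := by simp [letters]

theorem letters_getElem? {π : Equiv.Perm (Fin n)} {i v : ℕ} :
    (letters π)[i]? = some v ↔ ∃ j : Fin n, (j : ℕ) = i ∧ letter π j = v := by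
  rw [letters, List.getElem?_ofFn]
  constructor
  · intro h
    split_ifs at h with hi
    exact ⟨⟨i, hi⟩, rfl, Option.some_inj.1 h⟩
  · rintro ⟨j, rfl, rfl⟩
    simp

theorem mem_take_letters {π : Equiv.Perm (Fin n)} {i v : ℕ} :
    v ∈ (letters π).take i ↔ ∃ j : Fin n, (j : ℕ) < i ∧ letter π j = v := by
  rw [List.mem_iff_getElem?]
  constructor
  · rintro ⟨k, hk⟩
    rw [List.getElem?_take] at hk
    split_ifs at hk with hi
    obtain ⟨j, rfl, hj⟩ := letters_getElem?.1 hk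
    exact ⟨j, hi, hj⟩
  · rintro ⟨j, hj, rfl⟩
    refine ⟨j, ?_⟩
    rw [List.getElem?_take, if_pos hj]
    exact letters_getElem?.2 ⟨j, rfl, rfl⟩

theorem letters_perm (π : Equiv.Perm (Fin n)) : (letters π).Perm (List.range' 1 n) := by
  have hnd : (letters π).Nodup := List.nodup_ofFn.2 (letter_injective π)
  rw [List.perm_ext_iff_of_nodup hnd List.nodup_range']
  intro v
  rw [letters, List.mem_ofFn, List.mem_range'_1]
  constructor
  · rintro ⟨i, rfl⟩
    have := (π i).isLt
    simp only [letter]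
    omega
  · rintro ⟨h1, h2⟩
    refine ⟨π.symm ⟨v - 1, by omega⟩, ?_⟩
    simp only [letter, Equiv.apply_symm_apply]
    omega

theorem letters_injective : Function.Injective (letters (n := n)) := by
  intro π σ h
  ext i
  exact Nat.succ_injective (congrFun (List.ofFn_injective h) i)

theorem exists_letters_eq {l : List ℕ} (hl : l.Perm (List.range' 1 n)) :
    ∃ π : Equiv.Perm (Fin n), letters π = l := by
  have hlen : l.length = n := by simpa using hl.length_eq
  have hb (i : Fin n) : 1 ≤ l[(i : ℕ)] ∧ l[(i : ℕ)] < 1 + n :=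
    List.mem_range'_1.1 (hl.subset (List.getElem_mem _))
  have hinj : Function.Injective fun i : Fin n => (⟨l[(i : ℕ)] - 1, by
      have := hb i; omega⟩ : Fin n) := by
    intro i j h
    have h1 := hb i
    have h2 := hb j
    have h3 := congrArg Fin.val h
    simp only at h3
    exact Fin.ext ((hl.nodup_iff.2 List.nodup_range').getElem_inj_iff.1
      (show l[(i : ℕ)] = l[(j : ℕ)] by omega))
  refine ⟨Equiv.ofBijective _ (Finite.injective_iff_bijective.1 hinj),
    List.ext_getElem (by simp [letters, hlen]) fun i h1 h2 => ?_⟩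
  have := hb ⟨i, by omega⟩
  simp only [letters, letter, List.getElem_ofFn, Equiv.ofBijective_apply]
  simp only at this
  omega

theorem sublist_letters {π : Equiv.Perm (Fin n)} {q : List ℕ} :
    q.Sublist (letters π) ↔
      ∃ f : Fin q.length → Fin n, StrictMono f ∧ ∀ i, q.get i = letter π (f i) := by
  rw [List.sublist_iff_exists_fin_orderEmbedding_get_eq]
  constructor
  · rintro ⟨f, hf⟩
    refine ⟨fun i => (f i).cast (length_letters π), fun i j h => f.strictMono h, fun i => ?_⟩
    rw [hf i]
    simp [letters]
    rfl
  · rintro ⟨f, hf, h⟩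
    refine ⟨OrderEmbedding.ofStrictMono (fun i => (f i).cast (length_letters π).symm)
      fun i j hij => hf hij, fun i => ?_⟩
    rw [h i]
    simp [letters]
    rfl

theorem contains_312 {π : Equiv.Perm (Fin n)} :
    Contains π [3, 1, 2] ↔ ∃ a b c, [a, b, c].Sublist (letters π) ∧ b < c ∧ c < a := by
  constructor
  · rintro ⟨f, hf, h⟩
    refine ⟨letter π (f 0), letter π (f 1), letter π (f 2), sublist_letters.2 ⟨f, hf, ?_⟩,
      (h 1 2).2 (by simp), (h 2 0).2 (by simp)⟩
    intro i
    fin_cases i <;> rfl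
  · rintro ⟨a, b, c, hs, h1, h2⟩
    obtain ⟨f, hf, h⟩ := sublist_letters.1 hs
    refine ⟨f, hf, fun i j => ?_⟩
    have e : ∀ i, letter π (f i) = [a, b, c].get i := fun i => (h i).symm
    erw [e i, e j]
    fin_cases i <;> fin_cases j <;> simp <;> omega

theorem contains_3142 {π : Equiv.Perm (Fin n)} :
    Contains π [3, 1, 4, 2] ↔
      ∃ a b c d, [a, b, c, d].Sublist (letters π) ∧ b < d ∧ d < a ∧ a < c := by
  constructor
  · rintro ⟨f, hf, h⟩
    refine ⟨letter π (f 0), letter π (f 1), letter π (f 2), letter π (f 3),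
      sublist_letters.2 ⟨f, hf, ?_⟩, (h 1 3).2 (by simp), (h 3 0).2 (by simp), (h 0 2).2 (by simp)⟩
    intro i
    fin_cases i <;> rfl
  · rintro ⟨a, b, c, d, hs, h1, h2, h3⟩
    obtain ⟨f, hf, h⟩ := sublist_letters.1 hs
    refine ⟨f, hf, fun i j => ?_⟩
    have e : ∀ i, letter π (f i) = [a, b, c, d].get i := fun i => (h i).symm
    erw [e i, e j]
    fin_cases i <;> fin_cases j <;> simp <;> omega

theorem contains_2413 {π : Equiv.Perm (Fin n)} :
    Contains π [2, 4, 1, 3] ↔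
      ∃ a b c d, [a, b, c, d].Sublist (letters π) ∧ c < a ∧ a < d ∧ d < b := by
  constructor
  · rintro ⟨f, hf, h⟩
    refine ⟨letter π (f 0), letter π (f 1), letter π (f 2), letter π (f 3),
      sublist_letters.2 ⟨f, hf, ?_⟩, (h 2 0).2 (by simp), (h 0 3).2 (by simp), (h 3 1).2 (by simp)⟩
    intro i
    fin_cases i <;> rfl
  · rintro ⟨a, b, c, d, hs, h1, h2, h3⟩
    obtain ⟨f, hf, h⟩ := sublist_letters.1 hs
    refine ⟨f, hf, fun i j => ?_⟩
    have e : ∀ i, letter π (f i) = [a, b, c, d].get i := fun i => (h i).symm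
    erw [e i, e j]
    fin_cases i <;> fin_cases j <;> simp <;> omega

theorem mem_av_separable {π : Equiv.Perm (Fin n)} :
    π ∈ Av n {[2, 4, 1, 3], [3, 1, 4, 2]} ↔ Separable (letters π) := by
  simp only [Av, Set.mem_ofPred_eq, Set.mem_insert_iff, Set.mem_singleton_iff, forall_eq_or_imp,
    forall_eq, contains_2413, contains_3142, Separable]
  constructor
  · rintro ⟨h1, h2⟩ a b c d hs
    exact ⟨fun h => h2 ⟨a, b, c, d, hs, h⟩, fun h => h1 ⟨a, b, c, d, hs, h⟩⟩
  · intro h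
    exact ⟨fun ⟨a, b, c, d, hs, h'⟩ => (h a b c d hs).2 h',
      fun ⟨a, b, c, d, hs, h'⟩ => (h a b c d hs).1 h'⟩

theorem mem_av_312 {π : Equiv.Perm (Fin n)} :
    π ∈ Av n {[3, 1, 2]} ↔ Avoids312 (letters π) := by
  simp only [Av, Set.mem_ofPred_eq, Set.mem_singleton_iff, forall_eq, contains_312, Avoids312]
  exact ⟨fun h a b c hs h' => h ⟨a, b, c, hs, h'⟩, fun h ⟨a, b, c, hs, h'⟩ => h a b c hs h'⟩

/-- Both `2413` and `3142` contain `312`. -/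
theorem Avoids312.separable {l : List ℕ} (h : Avoids312 l) : Separable l := by
  intro a b c d hs
  constructor
  · rintro ⟨h1, h2, -⟩
    refine h a b d (List.Sublist.trans ?_ hs) ⟨h1, h2⟩
    exact ((List.sublist_cons_self c [d]).cons_cons b).cons_cons a
  · rintro ⟨h1, h2, h3⟩
    exact h b c d ((List.sublist_cons_self a _).trans hs) ⟨h1.trans h2, h3⟩

theorem mem_LMAX {π : Equiv.Perm (Fin n)} {v : ℕ} :
    v ∈ LMAX π ↔ v ∈ records (· < ·) (letters π) := by
  simp only [LMAX, records, Finset.mem_image, Finset.mem_filter, Finset.mem_univ, true_and,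
    Set.mem_ofPred_eq, letters_getElem?, mem_take_letters]
  constructor
  · rintro ⟨i, h, rfl⟩
    exact ⟨i, ⟨i, rfl, rfl⟩, fun x ⟨j, hj, hx⟩ => hx ▸ h j hj⟩
  · rintro ⟨_, ⟨i, rfl, rfl⟩, h⟩
    exact ⟨i, fun j hj => h _ ⟨j, hj, rfl⟩, rfl⟩

theorem mem_LMIN {π : Equiv.Perm (Fin n)} {v : ℕ} :
    v ∈ LMIN π ↔ v ∈ records (· > ·) (letters π) := by
  simp only [LMIN, records, Finset.mem_image, Finset.mem_filter, Finset.mem_univ, true_and,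
    Set.mem_ofPred_eq, letters_getElem?, mem_take_letters]
  constructor
  · rintro ⟨i, h, rfl⟩
    exact ⟨i, ⟨i, rfl, rfl⟩, fun x ⟨j, hj, hx⟩ => hx ▸ h j hj⟩
  · rintro ⟨_, ⟨i, rfl, rfl⟩, h⟩
    exact ⟨i, fun j hj => h _ ⟨j, hj, rfl⟩, rfl⟩

theorem mem_DES {π : Equiv.Perm (Fin n)} {d : ℕ} :
    d ∈ DES π ↔ ∃ i x y, d = i + 1 ∧ (letters π)[i]? = some x ∧
      (letters π)[i + 1]? = some y ∧ y < x := by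
  simp only [DES, Finset.mem_image, Finset.mem_filter, Finset.mem_univ, true_and,
    letters_getElem?]
  constructor
  · rintro ⟨i, ⟨j, hj, h⟩, rfl⟩
    exact ⟨i, _, _, rfl, ⟨i, rfl, rfl⟩, ⟨j, hj, rfl⟩, h⟩
  · rintro ⟨_, _, _, rfl, ⟨i, rfl, rfl⟩, ⟨j, hj, rfl⟩, h⟩
    exact ⟨i, ⟨j, hj, h⟩, rfl⟩

theorem mem_DESB {π : Equiv.Perm (Fin n)} {v : ℕ} :
    v ∈ DESB π ↔ v ∈ descentBottoms (letters π) := by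
  simp only [DESB, Finset.mem_image, Finset.mem_filter, Finset.mem_univ, true_and, mem_DES,
    descentBottoms, Set.mem_ofPred_eq]
  constructor
  · rintro ⟨j, ⟨i, hj, i', x, y, hi, hx, hy, h⟩, rfl⟩
    obtain rfl : (i : ℕ) = i' := by omega
    obtain ⟨j', hj', rfl⟩ := letters_getElem?.1 hy
    obtain rfl : j' = j := Fin.ext (by omega)
    exact ⟨i, x, hx, hy, h⟩
  · rintro ⟨k, x, hx, hv, h⟩
    obtain ⟨i, rfl, hi⟩ := letters_getElem?.1 hx
    obtain ⟨j, hj, hj'⟩ := letters_getElem?.1 hv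
    exact ⟨j, ⟨i, hj, i, x, v, rfl, hx, hv, h⟩, hj'⟩

theorem run_le_length (l : List ℕ) : run l ≤ l.length := by
  induction l with
  | nil => simp [run]
  | cons x l ih =>
    cases l with
    | nil => simp [run]
    | cons y l =>
      simp only [run]
      split_ifs
      · simp
      · simpa using ih

theorem run_eq_length_or (l : List ℕ) :
    run l = l.length ∨ ∃ i x y, run l = i + 1 ∧ l[i]? = some x ∧ l[i + 1]? = some y ∧ y < x := by
  induction l with
  | nil => exact .inl rfl
  | cons x l ih =>
    cases l with
    | nil => exact .inl rfl
    | cons y l =>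
      simp only [run]
      split_ifs with h
      · exact .inr ⟨0, x, y, rfl, rfl, rfl, h⟩
      · rcases ih with ih | ⟨i, u, v, h1, h2, h3, h4⟩
        · exact .inl (by rw [ih]; rfl)
        · exact .inr ⟨i + 1, u, v, by rw [h1], h2, h3, h4⟩

theorem run_le_of_descent {l : List ℕ} {i x y : ℕ} (hx : l[i]? = some x)
    (hy : l[i + 1]? = some y) (h : y < x) : run l ≤ i + 1 := by
  induction l generalizing i with
  | nil => simp at hx
  | cons u l ih =>
    cases l with
    | nil => simp [run]
    | cons v l =>
      simp only [run]
      split_ifs with huv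
      · omega
      · cases i with
        | zero =>
          simp only [List.getElem?_cons_zero, List.getElem?_cons_succ, Option.some_inj] at hx hy
          omega
        | succ i => exact Nat.succ_le_succ (ih hx hy)

theorem iar_eq_run (π : Equiv.Perm (Fin n)) : PermStat.iar π = run (letters π) := by
  apply le_antisymm
  · refine Finset.min'_le _ _ ?_
    rw [Finset.mem_insert, mem_DES]
    simpa [length_letters] using run_eq_length_or (letters π)
  · refine Finset.le_min' _ _ _ fun d hd => ?_
    rcases Finset.mem_insert.1 hd with rfl | hd
    · exact (run_le_length _).trans (length_letters π).le
    · obtain ⟨i, x, y, rfl, hx, hy, h⟩ := mem_DES.1 hd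
      exact run_le_of_descent hx hy h

/-- The letters of a prefix are at most its length `k` exactly if they are below all later letters:
in both cases the prefix is a permutation of `1, …, k`. -/
theorem take_le_iff_below {l : List ℕ} (hl : l.Perm (List.range' 1 n)) {k : ℕ} (hk : k ≤ n) :
    (∀ x ∈ l.take k, x ≤ k) ↔ Below (l.take k) (l.drop k) := by
  have hlen : l.length = n := by simpa using hl.length_eq
  have htake : (l.take k).length = k := by rw [List.length_take]; omega
  have hnd : l.Nodup := hl.nodup_iff.2 List.nodup_range'
  have hpos : ∀ x ∈ l, 1 ≤ x := fun x hx => (List.mem_range'_1.1 (hl.subset hx)).1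
  constructor
  · intro h
    have hsub : (l.take k).Subperm (List.range' 1 k) := by
      refine (hnd.sublist (List.take_sublist k l)).subperm fun x hx => ?_
      have := hpos x (List.mem_of_mem_take hx)
      have := h x hx
      rw [List.mem_range'_1]
      omega
    have hp := hsub.perm_of_length_le (by rw [htake, List.length_range'])
    intro x hx y hy
    refine lt_of_le_of_lt (h x hx) (lt_of_not_ge fun hle => ?_)
    have hy' : y ∈ l.take k := by
      rw [hp.mem_iff, List.mem_range'_1]
      have := hpos y (List.mem_of_mem_drop hy)
      omega
    rw [← List.take_append_drop k l, List.nodup_append] at hnd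
    exact hnd.2.2 y hy' y hy rfl
  · intro h x hx
    have hp := (perm_range'_of_below h (by rwa [List.take_append_drop])).1
    rw [htake] at hp
    have := List.mem_range'_1.1 (hp.subset hx)
    omega

theorem comp_eq_cuts (π : Equiv.Perm (Fin n)) : PermStat.comp π = cuts (letters π) := by
  classical
  rw [PermStat.comp, cuts, ← Finset.card_map Fin.valEmbedding]
  congr 1
  ext k
  have key (hk : k < n) : (∀ j : Fin n, j ≤ ⟨k, hk⟩ → letter π j ≤ k + 1) ↔
      Below ((letters π).take (k + 1)) ((letters π).drop (k + 1)) := by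
    rw [← take_le_iff_below (letters_perm π) hk]
    simp only [mem_take_letters]
    exact ⟨fun h x ⟨j, hj, hx⟩ => hx ▸ h j (Nat.le_of_lt_succ hj),
      fun h j hj => h _ ⟨j, Nat.lt_succ_of_le hj, rfl⟩⟩
  simp only [Finset.mem_map, Finset.mem_filter, Finset.mem_univ, true_and, Fin.valEmbedding_apply,
    Finset.mem_range, length_letters]
  constructor
  · rintro ⟨i, h, rfl⟩
    exact ⟨i.isLt, (key i.isLt).1 h⟩
  · rintro ⟨hk, h⟩
    exact ⟨⟨k, hk⟩, (key hk).2 h, rfl⟩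

/-! ### The involution on permutations -/

theorem exists_tree_of_mem_av {π : Equiv.Perm (Fin n)}
    (hπ : π ∈ Av n {[2, 4, 1, 3], [3, 1, 4, 2]}) :
    ∃ t : SepTree, t.Valid ∧ word 1 t = letters π :=
  exists_tree (letters_perm π) (mem_av_separable.1 hπ)

theorem exists_perm_of_size {t : SepTree} (ht : t.size = n) :
    ∃ π : Av n {[2, 4, 1, 3], [3, 1, 4, 2]}, letters π.1 = word 1 t := by
  obtain ⟨π, hπ⟩ := exists_letters_eq (ht ▸ word_perm 1 t)
  exact ⟨⟨π, mem_av_separable.2 (hπ ▸ separable_word 1 t)⟩, hπ⟩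

/-- The map on separable permutations induced by `SepTree.swap`, through its graph. -/
theorem exists_map_of_swap (n : ℕ) :
    ∃ Φ : Av n {[2, 4, 1, 3], [3, 1, 4, 2]} → Av n {[2, 4, 1, 3], [3, 1, 4, 2]},
      ∀ π, ∃ t : SepTree, t.Valid ∧ letters π.1 = word 1 t ∧ letters (Φ π).1 = word 1 t.swap := by
  have h (π : Av n {[2, 4, 1, 3], [3, 1, 4, 2]}) :
      ∃ (σ : Av n {[2, 4, 1, 3], [3, 1, 4, 2]}) (t : SepTree),
        t.Valid ∧ letters π.1 = word 1 t ∧ letters σ.1 = word 1 t.swap := by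
    obtain ⟨t, ht, e⟩ := exists_tree_of_mem_av π.2
    have hsize : t.swap.size = n := by
      rw [(swap_same ht).1, ← length_word 1 t, e, length_letters]
    obtain ⟨σ, hσ⟩ := exists_perm_of_size hsize
    exact ⟨σ, t, ht, e.symm, hσ⟩
  choose Φ hΦ using h
  exact ⟨Φ, hΦ⟩

theorem iar_eq_of_letters {π : Equiv.Perm (Fin n)} {t : SepTree} (ht : t.Valid)
    (e : letters π = word 1 t) : PermStat.iar π = t.iar := by
  rw [iar_eq_run, e, run_word ht]

theorem comp_eq_of_letters {π : Equiv.Perm (Fin n)} {t : SepTree} (ht : t.Valid)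
    (e : letters π = word 1 t) : PermStat.comp π = t.comp := by
  rw [comp_eq_cuts, e, cuts_word ht]

theorem equidistributed_of_involution {α β : Type*} {S : Set α} {f g : α → β} (φ : S → S)
    (hφ : Function.Involutive φ) (h : ∀ x, f (φ x).1 = g x.1) : Equidistributed S f g := by
  intro b
  have h' (x : S) : g (φ x).1 = f x.1 := by rw [← h, hφ x]
  refine Set.ncard_congr (fun x hx => (φ ⟨x, hx.1⟩).1) ?_ ?_ ?_
  · intro x hx
    exact ⟨(φ ⟨x, hx.1⟩).2, (h' _).trans hx.2⟩
  · intro x y hx hy e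
    exact congrArg Subtype.val (hφ.injective (Subtype.ext e))
  · intro y hy
    refine ⟨(φ ⟨y, hy.1⟩).1, ⟨(φ ⟨y, hy.1⟩).2, (h _).trans hy.2⟩, ?_⟩
    exact congrArg Subtype.val (hφ ⟨y, hy.1⟩)

end SepTree

theorem theorem1p2 (n : ℕ) :
    PermStat.Av n {[3, 1, 2]} ⊆ PermStat.Av n {[2, 4, 1, 3], [3, 1, 4, 2]} ∧
    (∃ Φ : PermStat.Av n {[2, 4, 1, 3], [3, 1, 4, 2]} → PermStat.Av n {[2, 4, 1, 3], [3, 1, 4, 2]},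
      Function.Involutive Φ ∧
      (∀ π, PermStat.LMAX (Φ π).1 = PermStat.LMAX π.1 ∧
        PermStat.LMIN (Φ π).1 = PermStat.LMIN π.1 ∧
        PermStat.DESB (Φ π).1 = PermStat.DESB π.1 ∧
        PermStat.comp (Φ π).1 = PermStat.iar π.1 ∧
        PermStat.iar (Φ π).1 = PermStat.comp π.1) ∧
      (∀ π, π.1 ∈ PermStat.Av n {[3, 1, 2]} → (Φ π).1 ∈ PermStat.Av n {[3, 1, 2]})) ∧
    (∀ S : Set (Equiv.Perm (Fin n)),
      S = PermStat.Av n {[2, 4, 1, 3], [3, 1, 4, 2]} ∨ S = PermStat.Av n {[3, 1, 2]} →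
      PermStat.Equidistributed S
        (fun π => (PermStat.LMAX π, PermStat.LMIN π, PermStat.DESB π, PermStat.iar π,
          PermStat.comp π))
        (fun π => (PermStat.LMAX π, PermStat.LMIN π, PermStat.DESB π, PermStat.comp π,
          PermStat.iar π))) := by
  have hsub : PermStat.Av n {[3, 1, 2]} ⊆ PermStat.Av n {[2, 4, 1, 3], [3, 1, 4, 2]} :=
    fun π hπ => SepTree.mem_av_separable.2 (SepTree.mem_av_312.1 hπ).separable
  obtain ⟨Φ, hΦ⟩ := SepTree.exists_map_of_swap n
  have hinv : Function.Involutive Φ := by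
    intro π
    obtain ⟨t, ht, e, e'⟩ := hΦ π
    obtain ⟨u, hu, h, h'⟩ := hΦ (Φ π)
    obtain rfl := SepTree.word_injective (SepTree.swap_valid ht) hu (e'.symm.trans h)
    rw [SepTree.swap_swap ht, ← e] at h'
    exact Subtype.ext (SepTree.letters_injective h')
  have hstat : ∀ π, PermStat.LMAX (Φ π).1 = PermStat.LMAX π.1 ∧
      PermStat.LMIN (Φ π).1 = PermStat.LMIN π.1 ∧
      PermStat.DESB (Φ π).1 = PermStat.DESB π.1 ∧
      PermStat.comp (Φ π).1 = PermStat.iar π.1 ∧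
      PermStat.iar (Φ π).1 = PermStat.comp π.1 := by
    intro π
    obtain ⟨t, ht, e, e'⟩ := hΦ π
    have hs := (SepTree.swap_same ht).2 1
    rw [← e, ← e'] at hs
    simp only [SepTree.stats, Prod.mk.injEq] at hs
    obtain ⟨h1, h2, h3⟩ := hs
    refine ⟨?_, ?_, ?_, ?_, ?_⟩
    · ext v
      rw [SepTree.mem_LMAX, SepTree.mem_LMAX, h1]
    · ext v
      rw [SepTree.mem_LMIN, SepTree.mem_LMIN, h2]
    · ext v
      rw [SepTree.mem_DESB, SepTree.mem_DESB, h3]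
    · rw [SepTree.comp_eq_of_letters (SepTree.swap_valid ht) e', SepTree.comp_swap ht,
        SepTree.iar_eq_of_letters ht e]
    · rw [SepTree.iar_eq_of_letters (SepTree.swap_valid ht) e', SepTree.iar_swap ht,
        SepTree.comp_eq_of_letters ht e]
  have h312 : ∀ π, π.1 ∈ PermStat.Av n {[3, 1, 2]} → (Φ π).1 ∈ PermStat.Av n {[3, 1, 2]} := by
    intro π hπ
    obtain ⟨t, ht, e, e'⟩ := hΦ π
    rw [SepTree.mem_av_312, e] at hπ
    rw [SepTree.mem_av_312, e']
    exact SepTree.avoids312_word (SepTree.swap_simple (SepTree.simple_of_avoids312 ht hπ)) 1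
  have hquint (π : PermStat.Av n {[2, 4, 1, 3], [3, 1, 4, 2]}) :
      (PermStat.LMAX (Φ π).1, PermStat.LMIN (Φ π).1, PermStat.DESB (Φ π).1,
        PermStat.iar (Φ π).1, PermStat.comp (Φ π).1) =
      (PermStat.LMAX π.1, PermStat.LMIN π.1, PermStat.DESB π.1,
        PermStat.comp π.1, PermStat.iar π.1) := by
    obtain ⟨h1, h2, h3, h4, h5⟩ := hstat π
    rw [h1, h2, h3, h4, h5]
  refine ⟨hsub, ⟨Φ, hinv, hstat, h312⟩, ?_⟩
  rintro S (rfl | rfl)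
  · exact SepTree.equidistributed_of_involution Φ hinv hquint
  · refine SepTree.equidistributed_of_involution
      (fun π => ⟨(Φ ⟨π.1, hsub π.2⟩).1, h312 _ π.2⟩) (fun π => ?_) fun π => hquint _
    have h : (Φ (Φ ⟨π.1, hsub π.2⟩)).1 = π.1 := congrArg Subtype.val (hinv _)
    exact Subtype.ext h
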